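/- Let $n,m,t\ge 0$ be integers, let $\mathbb F_q$ be a finite field, and let $A_1,\dots,A_m\subseteq[n]$ be arbitrary sets (the storage structure). There are $n$ storage nodes, $m$ secrets, and one user for each $t$-subset $T\subseteq[m]$, who demands the secrets $s_j$, $j\in T$, and has access to all nodes in $\bigcup_{j\in T}A_j$. The secrets $s_j\in\mathbb F_q^{r_j}$ are mutually independent and uniformly distributed. A protocol consists of a (possibly randomized) encoder mapping $(s_1,\dots,s_m)$ to a vector of finitely many shares in $\mathbb F_q$, a storage profile specifying which shares are stored in which node, with at most $K\ge1$ shares in each node, and decoders recovering, without error, each $s_j$ from the shares stored in the nodes of $A_j$. It is weakly secure if $H(s_\ell\mid U_T)=H(s_\ell)$ for every $t$-subset $T\subseteq[m]$ and every $\ell\in[m]\setminus T$, where $U_T$ denotes all shares stored in the nodes of $\bigcup_{j\in T}A_j$. Its rate tuple is $(r_1/K,\dots,r_m/K)$. The capacity region is the closure in $\mathbb R^m$ of the set of rate tuples of all weakly secure protocols over $\mathbb F_q$ (with arbitrary $K\geq 1$ and $r_1,\dots,r_m\ge 0$). Then the capacity region is the convex hull of the set of all $(R_1,\dots,R_m)\in\mathbb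 R_{\ge0}^m$ satisfying $$R_j\le\Bigl|A_j\setminus\bigcup_{j'\in S}A_{j'}\Bigr|\quad\text{for all } j\in[m],\ S\subseteq[m]\setminus\{j\},\ |S|=t,$$ $$\sum_{i\in S}R_i\le\Bigl|\bigcup_{i\in S}A_i\Bigr|\quad\text{for all } S\subseteq[m].$$ -/

import Mathlib

namespace DMUSS

/-! ### Shannon entropy on finite types -/

/-- Shannon entropy `H(X) = -∑ p(a) log p(a)` of a random variable with law `p`. -/
noncomputable def entropy {α : Type*} [Fintype α] (p : PMF α) : ℝ :=
  ∑ a, Real.negMulLog (p a).toReal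

/-- Conditional entropy `H(X | Y) = ∑ p(a,b) log (p(b) / p(a,b))` of a pair `(X, Y)` with joint
law `p`. Terms with `p(a,b) = 0` contribute `0`. -/
noncomputable def condEntropy {α β : Type*} [Fintype α] [Fintype β] (p : PMF (α × β)) : ℝ :=
  ∑ a, ∑ b, (p (a, b)).toReal * Real.log ((p.map Prod.snd b).toReal / (p (a, b)).toReal)

/-! ### Secret sharing protocols -/

/-- The tuples of `m` secrets, where the `j`-th secret consists of `r j` symbols of `F`. -/
abbrev Secrets (F : Type*) {m : ℕ} (r : Fin m → ℕ) : Type _ :=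
  (j : Fin m) → Fin (r j) → F

/-- Indices of all shares that are stored in the nodes of `B`, where `store i` is the set of
(indices of) shares stored in node `i`. -/
def visible {n h : ℕ} (store : Fin n → Finset (Fin h)) (B : Finset (Fin n)) : Finset (Fin h) :=
  B.biUnion store

/-- The data read off the nodes of `B` when the vector of all shares is `y`. -/
def view {F : Type*} {n h : ℕ} (store : Fin n → Finset (Fin h)) (B : Finset (Fin n))
    (y : Fin h → F) : visible store B → F :=
  fun k => y k

/-- A distributed secret sharing protocol over `F` with `n` storage nodes and `m` secrets, storage
structure `A` and secret lengths `r`: a (randomized) encoder of the secrets into `h` shares, a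
storage profile, and one decoder per secret, acting on the shares in the storage set of that
secret. -/
structure Protocol (F : Type*) {n m : ℕ} (A : Fin m → Finset (Fin n)) (r : Fin m → ℕ) where
  /-- number of shares -/
  h : ℕ
  /-- storage profile: share `k` is stored in node `i` iff `k ∈ store i` -/
  store : Fin n → Finset (Fin h)
  /-- encoder; `enc s` is the conditional law of the share vector given the secrets `s` -/
  enc : Secrets F r → PMF (Fin h → F)
  /-- decoders -/
  dec : (j : Fin m) → (visible store (A j) → F) → (Fin (r j) → F)

namespace Protocol

variable {F : Type*} {n m : ℕ} {A : Fin m → Finset (Fin n)} {r : Fin m → ℕ}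

/-- Every storage node holds at most `K` symbols. -/
def HasNodeSize (P : Protocol F A r) (K : ℕ) : Prop :=
  ∀ i, (P.store i).card ≤ K

/-- Correctness: each secret is recovered, without error, from the data in its storage set. -/
def Correct (P : Protocol F A r) : Prop :=
  ∀ s, ∀ y ∈ (P.enc s).support, ∀ j, P.dec j (view P.store (A j) y) = s j

/-- Joint law of the secrets and the shares: the secrets are independent and uniform. -/
noncomputable def joint [Fintype F] [Nonempty F] (P : Protocol F A r) :
    PMF (Secrets F r × (Fin P.h → F)) :=
  (PMF.uniformOfFintype (Secrets F r)).bind fun s => (P.enc s).map fun y => (s, y)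

/-- The data accessible to the user who demands the secrets in `S`: the content of all nodes in
`⋃ j ∈ S, A j`. -/
def userView (P : Protocol F A r) (S : Finset (Fin m)) (y : Fin P.h → F) :
    visible P.store (S.biUnion A) → F :=
  view P.store (S.biUnion A) y

/-- Weak secrecy, when there is one user for every set of `t` secrets:
`H(s_l | U_S) = H(s_l)` for every user `S` and every secret `l` not demanded by that user. -/
def WeaklySecure [Fintype F] [Nonempty F] (P : Protocol F A r) (t : ℕ) : Prop :=
  ∀ S : Finset (Fin m), S.card = t → ∀ l, l ∉ S →
    condEntropy (P.joint.map fun x => (x.1 l, P.userView S x.2)) =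
      entropy (P.joint.map fun x => x.1 l)

end Protocol

/-- `R` is the rate tuple of some correct, weakly secure protocol: `R j = r j / K`, where `r j` is
the length of the `j`-th secret and `K ≥ 1` is the size of each storage node. -/
def IsProtocolRate (F : Type*) [Fintype F] [Nonempty F] {n m : ℕ}
    (A : Fin m → Finset (Fin n)) (t : ℕ) (R : Fin m → ℝ) : Prop :=
  ∃ (K : ℕ) (r : Fin m → ℕ) (P : Protocol F A r),
    0 < K ∧ P.HasNodeSize K ∧ P.Correct ∧ P.WeaklySecure t ∧ ∀ j, R j = (r j : ℝ) / (K : ℝ)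

/-- The capacity region: a tuple of real rates is achievable if it is approximated arbitrarily
well by the rate tuples of correct and weakly secure protocols. -/
def capacityRegion (F : Type*) [Fintype F] [Nonempty F] {n m : ℕ}
    (A : Fin m → Finset (Fin n)) (t : ℕ) : Set (Fin m → ℝ) :=
  closure {R | IsProtocolRate F A t R}

end DMUSS

namespace DMUSS

/-! ### Uniform laws and entropy -/

/-! The inequalities cut out a closed convex polyhedron, so the convex hull changes nothing and two
inclusions remain. Converse: beyond a user's view, secret `l` depends on at most `K * |A l \
S.biUnion A|` further shares, which bounds its conditional entropy; weak secrecy makes that entropy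
the full `r l * log |F|` (`length_le_of_weaklySecure`). The sum bound is counting (`sum_length_le`).
Achievability: decode linearly, by a generic matrix over a finite extension `E` whose zeros respect
the storage structure (`exists_generic_matrix`), and encode by a uniform preimage. Hall's theorem
turns the sum bounds into invertibility on all columns, hence correctness; the other bounds give
invertibility on the columns of one secret using only rows a user cannot see, hence secrecy
(`exists_protocol_of_linearMap`). Each symbol of `E` becomes `d` symbols of `F`, which leaves rates
unchanged. -/

theorem eq_uniformOfFintype_of_const {α : Type*} [Fintype α] [Nonempty α] (p : PMF α)
    (h : ∀ a b, p a = p b) : p = PMF.uniformOfFintype α := by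
  ext a
  rw [PMF.uniformOfFintype_apply]
  refine ENNReal.eq_inv_of_mul_eq_one_left ?_
  have h1 := p.tsum_coe
  rw [tsum_fintype, Finset.sum_congr rfl fun b _ => h b a] at h1
  simpa [mul_comm] using h1

/-- The fibres are translates of the kernel, so they all have the same mass. -/
theorem map_uniformOfFintype_of_surjective {G H : Type*} [AddGroup G] [AddGroup H] [Fintype G]
    [Fintype H] (f : G →+ H) (hf : Function.Surjective f) :
    (PMF.uniformOfFintype G).map f = PMF.uniformOfFintype H := by
  classical
  refine eq_uniformOfFintype_of_const _ ?_
  suffices h : ∀ b, (PMF.uniformOfFintype G).map f b = (PMF.uniformOfFintype G).map f 0 from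
    fun a b => (h a).trans (h b).symm
  intro b
  obtain ⟨g, rfl⟩ := hf b
  rw [PMF.map_apply, PMF.map_apply, ← (Equiv.addRight g).tsum_eq]
  refine tsum_congr fun a => ?_
  simp [eq_comm]

theorem uniformOfFintype_bind_map_mk {α β : Type*} [Fintype α] [Fintype β] [Nonempty α]
    [Nonempty β] :
    ((PMF.uniformOfFintype α).bind fun a => (PMF.uniformOfFintype β).map (Prod.mk a)) =
      PMF.uniformOfFintype (α × β) := by
  classical
  refine eq_uniformOfFintype_of_const _ ?_
  suffices h : ∀ x : α × β,
      ((PMF.uniformOfFintype α).bind fun a => (PMF.uniformOfFintype β).map (Prod.mk a)) x =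
        (Fintype.card α : ENNReal)⁻¹ * (Fintype.card β : ENNReal)⁻¹ from
    fun x y => (h x).trans (h y).symm
  rintro ⟨a, b⟩
  rw [PMF.bind_apply, tsum_eq_single a]
  · rw [PMF.map_apply, tsum_eq_single b]
    · simp
    · intro b' hb'
      simp [hb'.symm]
  · intro a' ha'
    simp [PMF.map_apply, ha'.symm]

theorem entropy_uniformOfFintype {α : Type*} [Fintype α] [Nonempty α] :
    entropy (PMF.uniformOfFintype α) = Real.log (Fintype.card α) := by
  have : (Fintype.card α : ℝ) ≠ 0 := by simp
  simp only [entropy, PMF.uniformOfFintype_apply, Real.negMulLog, Finset.sum_const,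
    Finset.card_univ, ENNReal.toReal_inv, ENNReal.toReal_natCast, Real.log_inv, nsmul_eq_mul]
  field_simp

theorem condEntropy_uniformOfFintype {α β : Type*} [AddGroup α] [AddGroup β] [Fintype α]
    [Fintype β] :
    condEntropy (PMF.uniformOfFintype (α × β)) = Real.log (Fintype.card α) := by
  have h1 : (Fintype.card α : ℝ) ≠ 0 := by simp
  have h2 : (Fintype.card β : ℝ) ≠ 0 := by simp
  have h : (PMF.uniformOfFintype (α × β)).map Prod.snd = PMF.uniformOfFintype β :=
    map_uniformOfFintype_of_surjective (AddMonoidHom.snd α β) Prod.snd_surjective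
  simp only [condEntropy, h, PMF.uniformOfFintype_apply, Finset.sum_const,
    Finset.card_univ, ENNReal.toReal_inv, ENNReal.toReal_mul, ENNReal.toReal_natCast, nsmul_eq_mul,
    Fintype.card_prod, Nat.cast_mul]
  have h3 : ((Fintype.card β : ℝ)⁻¹ / ((Fintype.card α : ℝ) * Fintype.card β)⁻¹) =
      Fintype.card α := by field_simp
  rw [h3]
  field_simp

/-- If, given the second component, the first one is a function of a variable with values in `γ`,
then the conditional entropy is at most `log |γ|`. -/
theorem condEntropy_le_log_card {α β γ : Type*} [Fintype α] [Fintype β] [Fintype γ] [Nonempty γ]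
    (p : PMF (α × β)) (g : γ → β → α) (hg : ∀ a b, p (a, b) ≠ 0 → ∃ c, g c b = a) :
    condEntropy p ≤ Real.log (Fintype.card γ) := by
  classical
  have hM : (0 : ℝ) < Fintype.card γ := by exact_mod_cast Fintype.card_pos
  set M : ℝ := (Fintype.card γ : ℝ)
  set q : β → ℝ := fun b => (p.map Prod.snd b).toReal with hq
  have hmarg : ∀ b, q b = ∑ a, (p (a, b)).toReal := by
    intro b
    simp only [hq, PMF.map_apply, tsum_fintype, Fintype.sum_prod_type]
    rw [ENNReal.toReal_sum]
    · refine Finset.sum_congr rfl fun a _ => ?_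
      simp
    · intro a _
      simp [PMF.apply_ne_top]
  have hsum : ∑ b, q b = 1 := by
    have h1 := (p.map Prod.snd).tsum_coe
    rw [tsum_fintype] at h1
    simp only [hq]
    rw [← ENNReal.toReal_sum fun b _ => PMF.apply_ne_top _ _, h1, ENNReal.toReal_one]
  have key : ∀ b, ∑ a, (p (a, b)).toReal * Real.log (q b / (p (a, b)).toReal) ≤
      q b * Real.log M := by
    intro b
    have hqb : 0 ≤ q b := ENNReal.toReal_nonneg
    -- This is `log x ≤ x - 1` at `x = q b / (M * p (a, b))`. In the sum over `a` the corrections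
    -- are nonpositive, since at most `M` values of `a` have positive mass.
    have hterm : ∀ a, (p (a, b)).toReal * Real.log (q b / (p (a, b)).toReal) ≤
        (p (a, b)).toReal * Real.log M - (p (a, b)).toReal +
          if p (a, b) ≠ 0 then q b / M else 0 := by
      intro a
      by_cases ha : p (a, b) = 0
      · simp [ha]
      have hpos : 0 < (p (a, b)).toReal := ENNReal.toReal_pos ha (PMF.apply_ne_top _ _)
      have hqpos : 0 < q b := by
        rw [hmarg]
        exact hpos.trans_le (Finset.single_le_sum
          (f := fun a => (p (a, b)).toReal) (fun _ _ => ENNReal.toReal_nonneg)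
          (Finset.mem_univ a))
      rw [if_pos ha]
      have h1 : Real.log (q b / (p (a, b)).toReal) =
          Real.log M + Real.log (q b / M / (p (a, b)).toReal) := by
        rw [← Real.log_mul hM.ne' (by positivity)]
        congr 1
        field_simp
      have h2 := Real.log_le_sub_one_of_pos (x := q b / M / (p (a, b)).toReal) (by positivity)
      rw [h1]
      have h3 : (p (a, b)).toReal * (q b / M / (p (a, b)).toReal - 1) =
          q b / M - (p (a, b)).toReal := by field_simp
      have h4 := mul_le_mul_of_nonneg_left h2 hpos.le
      rw [h3] at h4
      rw [mul_add]
      linarith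
    refine (Finset.sum_le_sum fun a _ => hterm a).trans ?_
    rw [Finset.sum_add_distrib, Finset.sum_sub_distrib, ← Finset.sum_mul, ← hmarg,
      ← Finset.sum_filter, Finset.sum_const, nsmul_eq_mul]
    have hcard : ((Finset.univ.filter fun a => p (a, b) ≠ 0).card : ℝ) ≤ M := by
      have hsub : (Finset.univ.filter fun a => p (a, b) ≠ 0) ⊆
          Finset.univ.image fun c => g c b := by
        intro a ha
        obtain ⟨c, hc⟩ := hg a b (Finset.mem_filter.1 ha).2
        exact Finset.mem_image.2 ⟨c, Finset.mem_univ _, hc⟩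
      exact Nat.cast_le.2 ((Finset.card_le_card hsub).trans Finset.card_image_le)
    have h5 : ((Finset.univ.filter fun a => p (a, b) ≠ 0).card : ℝ) * (q b / M) ≤ q b := by
      calc _ ≤ M * (q b / M) := mul_le_mul_of_nonneg_right hcard (by positivity)
        _ = q b := by field_simp
    linarith
  rw [condEntropy, Finset.sum_comm]
  refine (Finset.sum_le_sum fun b _ => key b).trans ?_
  rw [← Finset.sum_mul, hsum, one_mul]

/-! ### Upper bounds on the rates -/

theorem card_visible_le {n h K : ℕ} {store : Fin n → Finset (Fin h)}
    (hK : ∀ i, (store i).card ≤ K) (B : Finset (Fin n)) :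
    (visible store B).card ≤ K * B.card := by
  rw [mul_comm]
  exact Finset.card_biUnion_le_card_mul _ _ _ fun i _ => hK i

namespace Protocol

variable {F : Type*} [Field F] [Fintype F] {n m : ℕ} {A : Fin m → Finset (Fin n)} {r : Fin m → ℕ}

theorem joint_map_secret (P : Protocol F A r) (l : Fin m) :
    (P.joint.map fun x => x.1 l) = PMF.uniformOfFintype (Fin (r l) → F) := by
  have h : (P.joint.map fun x => x.1 l) =
      (PMF.uniformOfFintype (Secrets F r)).map fun s => s l := by
    simp only [joint, PMF.map_bind, PMF.map_comp]
    rw [← PMF.bind_pure_comp]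
    refine congrArg _ (funext fun s => ?_)
    exact PMF.map_const _ _
  rw [h]
  exact map_uniformOfFintype_of_surjective
    (Pi.evalAddMonoidHom (fun j => Fin (r j) → F) l) (Function.surjective_eval l)

theorem mem_support_enc_of_joint_ne_zero (P : Protocol F A r) {s : Secrets F r} {y : Fin P.h → F}
    (h : (s, y) ∈ P.joint.support) : y ∈ (P.enc s).support := by
  simp only [joint, PMF.mem_support_bind_iff, PMF.mem_support_map_iff] at h
  obtain ⟨s', -, y', hy', he⟩ := h
  obtain ⟨rfl, rfl⟩ := Prod.mk.inj he
  exact hy'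

theorem length_le_of_weaklySecure (P : Protocol F A r) {K t : ℕ} (hK : P.HasNodeSize K)
    (hc : P.Correct) (hs : P.WeaklySecure t) {S : Finset (Fin m)} (hS : S.card = t) {l : Fin m}
    (hl : l ∉ S) : r l ≤ K * (A l \ S.biUnion A).card := by
  classical
  have h := hs S hS l hl
  rw [P.joint_map_secret, entropy_uniformOfFintype] at h
  -- Run the decoder on the user's shares completed by the missing ones; the default `0` is never
  -- used, as every share in `A l` is of one of the two kinds.
  let g : (visible P.store (A l \ S.biUnion A) → F) → (visible P.store (S.biUnion A) → F) →
      (Fin (r l) → F) := fun c u => P.dec l fun k =>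
        if hk : (k : Fin P.h) ∈ visible P.store (S.biUnion A) then u ⟨k, hk⟩ else
          if hk' : (k : Fin P.h) ∈ visible P.store (A l \ S.biUnion A) then c ⟨k, hk'⟩ else 0
  have hle := condEntropy_le_log_card
    (P.joint.map fun x => (x.1 l, P.userView S x.2)) g (by
      intro a b hab
      have hab' : (a, b) ∈ (P.joint.map fun x => (x.1 l, P.userView S x.2)).support := hab
      rw [PMF.mem_support_map_iff] at hab'
      obtain ⟨⟨s, y⟩, hsy, he⟩ := hab'
      obtain ⟨rfl, rfl⟩ := Prod.mk.inj he
      refine ⟨view P.store _ y, ?_⟩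
      refine Eq.trans ?_ (hc s y (P.mem_support_enc_of_joint_ne_zero hsy) l)
      refine congrArg (P.dec l) (funext fun k => ?_)
      by_cases hk : (k : Fin P.h) ∈ visible P.store (S.biUnion A)
      · simp [hk, userView, view]
      · have hk' : (k : Fin P.h) ∈ visible P.store (A l \ S.biUnion A) := by
          obtain ⟨i, hi, hki⟩ := Finset.mem_biUnion.1 k.2
          refine Finset.mem_biUnion.2 ⟨i, Finset.mem_sdiff.2 ⟨hi, fun hi' => hk ?_⟩, hki⟩
          exact Finset.mem_biUnion.2 ⟨i, hi', hki⟩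
        simp [hk, hk', view])
  rw [h, Real.log_le_log_iff (by exact_mod_cast Fintype.card_pos)
    (by exact_mod_cast Fintype.card_pos), Nat.cast_le] at hle
  simp only [Fintype.card_fun, Fintype.card_fin, Fintype.card_coe] at hle
  exact ((Nat.pow_le_pow_iff_right Fintype.one_lt_card).1 hle).trans (card_visible_le hK _)

/-- Fix one possible share vector for each tuple of secrets, with zero secrets outside `S`.
Correctness makes the view of `S.biUnion A` injective in the remaining secrets. -/
theorem sum_length_le (P : Protocol F A r) {K : ℕ} (hK : P.HasNodeSize K) (hc : P.Correct)
    (S : Finset (Fin m)) : ∑ i ∈ S, r i ≤ K * (S.biUnion A).card := by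
  classical
  choose y hy using fun s => (P.enc s).support_nonempty
  let ext : ((j : S) → Fin (r j) → F) → Secrets F r := fun s j =>
    if hj : j ∈ S then s ⟨j, hj⟩ else 0
  have hinj : Function.Injective fun s => view P.store (S.biUnion A) (y (ext s)) := by
    intro s s' hss
    funext j
    have e : view P.store (A j) (y (ext s)) = view P.store (A j) (y (ext s')) := by
      funext k
      have hk : (k : Fin P.h) ∈ visible P.store (S.biUnion A) :=
        Finset.biUnion_subset_biUnion_of_subset_left _
          (Finset.subset_biUnion_of_mem A j.2) k.2
      exact congrFun hss ⟨k, hk⟩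
    have h1 := hc _ _ (hy (ext s)) j
    rw [e, hc _ _ (hy (ext s')) j] at h1
    simpa [ext] using h1.symm
  have hcard := Fintype.card_le_of_injective _ hinj
  simp only [Fintype.card_pi, Fintype.card_fin, Fintype.card_coe,
    Finset.prod_const, Finset.card_univ] at hcard
  rw [Finset.prod_pow_eq_pow_sum, Nat.pow_le_pow_iff_right Fintype.one_lt_card,
    Finset.sum_coe_sort S r] at hcard
  exact hcard.trans (card_visible_le hK _)

end Protocol

end DMUSS
namespace DMUSS

/-! ### Generic matrices with prescribed zeros -/

/-- Over some finite extension of `F` there is a matrix supported on `allowed` all of whose square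
submatrices containing a transversal of `allowed` are invertible. -/
theorem exists_generic_matrix (F : Type*) [Field F] {ρ γ : Type*} [Fintype ρ] [Fintype γ]
    [DecidableEq ρ] [DecidableEq γ] (allowed : ρ → γ → Prop) :
    ∃ (E : IntermediateField F (AlgebraicClosure F)) (_ : FiniteDimensional F E) (G : ρ → γ → E),
      (∀ i c, ¬ allowed i c → G i c = 0) ∧
      ∀ (C : Finset γ) (f : γ → ρ), Set.InjOn f C → (∀ c ∈ C, allowed (f c) c) →
        (Matrix.of fun c' c : C => G (f c') c).det ≠ 0 := by
  classical
  let L := AlgebraicClosure F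
  let X : Matrix ρ γ (MvPolynomial (ρ × γ) L) :=
    fun i c => if allowed i c then MvPolynomial.X (i, c) else 0
  let good : Finset (Finset γ × (γ → ρ)) := Finset.univ.filter fun q =>
    Set.InjOn q.2 q.1 ∧ ∀ c ∈ q.1, allowed (q.2 c) c
  let p : MvPolynomial (ρ × γ) L := ∏ q ∈ good,
    (Matrix.of fun c' c : q.1 => X (q.2 c') c).det
  have heval : ∀ (x : ρ × γ → L) (C : Finset γ) (f : γ → ρ),
      MvPolynomial.eval x (Matrix.of fun c' c : C => X (f c') c).det =
        (Matrix.of fun c' c : C => if allowed (f c') c then x (f c', c) else 0).det := by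
    intro x C f
    rw [RingHom.map_det]
    congr 1
    ext c' c
    simp only [RingHom.mapMatrix_apply, Matrix.map_apply, Matrix.of_apply, X]
    split_ifs <;> simp
  have hp : p ≠ 0 := by
    refine Finset.prod_ne_zero_iff.2 fun q hq h0 => ?_
    obtain ⟨-, hinj, hall⟩ := Finset.mem_filter.1 hq
    -- At the indicator of the transversal the submatrix is the identity, so its determinant is a
    -- nonzero polynomial.
    have h1 := heval (fun z => if z.1 = q.2 z.2 then 1 else 0) q.1 q.2
    rw [h0, map_zero] at h1
    have h2 : (Matrix.of fun c' c : q.1 => if allowed (q.2 c') c then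
        (if q.2 c' = q.2 c then (1 : L) else 0) else 0) = 1 := by
      ext c' c
      by_cases hcc : c' = c
      · subst hcc
        simp [hall _ c'.2]
      · have : q.2 c' ≠ q.2 c := fun h => hcc (Subtype.ext (hinj c'.2 c.2 h))
        simp [this, hcc]
    rw [h2, Matrix.det_one] at h1
    exact zero_ne_one h1
  obtain ⟨x, hx⟩ : ∃ x, MvPolynomial.eval x p ≠ 0 := by
    by_contra! h
    exact hp (MvPolynomial.funext fun x => by simpa using h x)
  let E : IntermediateField F L := IntermediateField.adjoin F (Set.range x)
  have hE : FiniteDimensional F E := IntermediateField.finiteDimensional_adjoin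
    fun a _ => (Algebra.IsAlgebraic.isAlgebraic a).isIntegral
  let G : ρ → γ → E := fun i c => if allowed i c then
    ⟨x (i, c), IntermediateField.subset_adjoin _ _ ⟨_, rfl⟩⟩ else 0
  refine ⟨E, hE, G, fun i c h => if_neg h, fun C f hinj hall h0 => ?_⟩
  have h1 : MvPolynomial.eval x (Matrix.of fun c' c : C => X (f c') c).det ≠ 0 := by
    rw [map_prod] at hx
    exact Finset.prod_ne_zero_iff.1 hx (C, f)
      (Finset.mem_filter.2 ⟨Finset.mem_univ _, hinj, hall⟩)
  rw [heval] at h1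
  apply h1
  have h2 := congrArg (algebraMap E L) h0
  rw [map_zero, RingHom.map_det] at h2
  refine Eq.trans ?_ h2
  congr 1
  ext c' c
  simp only [RingHom.mapMatrix_apply, Matrix.map_apply, Matrix.of_apply, G]
  split_ifs <;> simp

/-- A linear system whose matrix has an invertible square submatrix with rows `f '' C` and columns
`C` has solutions supported on the rows `f '' C`, for any right-hand side on `C`. -/
theorem exists_vecMul_eq {E ρ γ : Type*} [Field E] [Fintype ρ] [DecidableEq ρ] [DecidableEq γ]
    (G : ρ → γ → E) (C : Finset γ) (f : γ → ρ)
    (hdet : (Matrix.of fun c' c : C => G (f c') c).det ≠ 0) (w : γ → E) :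
    ∃ y : ρ → E, (∀ i, (∀ c ∈ C, f c ≠ i) → y i = 0) ∧ ∀ c ∈ C, ∑ i, y i * G i c = w c := by
  set N : Matrix C C E := Matrix.of fun c' c : C => G (f c') c
  let z : C → E := Matrix.vecMul (fun c : C => w c) N⁻¹
  have hz : Matrix.vecMul z N = fun c : C => w c := by
    rw [Matrix.vecMul_vecMul, Matrix.nonsing_inv_mul _ (isUnit_iff_ne_zero.2 hdet),
      Matrix.vecMul_one]
  refine ⟨fun i => ∑ c : C, if f c = i then z c else 0, fun i hi => ?_, fun c hc => ?_⟩
  · exact Finset.sum_eq_zero fun c _ => if_neg (hi c c.2)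
  · rw [← congrFun hz ⟨c, hc⟩]
    simp only [Finset.sum_mul, ite_mul, zero_mul]
    rw [Finset.sum_comm]
    simp [Matrix.vecMul, dotProduct, N]

end DMUSS
namespace DMUSS

/-! ### Protocols from linear maps -/

/-- A linear map from share vectors to secrets gives a protocol: the shares are uniform among those
that are mapped to the given secrets. -/
theorem exists_protocol_of_linearMap {F : Type*} [Field F] [Fintype F] {n m h : ℕ}
    {A : Fin m → Finset (Fin n)} {r : Fin m → ℕ} (t : ℕ) (store : Fin n → Finset (Fin h))
    (D : (Fin h → F) →ₗ[F] Secrets F r) (hD : Function.Surjective D)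
    (hlocal : ∀ j y, (∀ k ∈ visible store (A j), y k = 0) → D y j = 0)
    (hsec : ∀ S : Finset (Fin m), S.card = t → ∀ l, l ∉ S → ∀ w,
      ∃ y, (∀ k ∈ visible store (S.biUnion A), y k = 0) ∧ D y l = w) :
    ∃ P : Protocol F A r, (∀ K, (∀ i, (store i).card ≤ K) → P.HasNodeSize K) ∧
      P.Correct ∧ P.WeaklySecure t := by
  classical
  obtain ⟨σ, hσ⟩ := D.exists_rightInverse_of_surjective (LinearMap.range_eq_top.2 hD)
  have hσ' : ∀ s, D (σ s) = s := fun s => LinearMap.congr_fun hσ s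
  let P : Protocol F A r :=
    { h := h
      store := store
      enc := fun s => PMF.map (fun k : LinearMap.ker D => σ s + (k : Fin h → F))
        (PMF.uniformOfFintype (LinearMap.ker D))
      dec := fun j v => D (fun k => if hk : k ∈ visible store (A j) then v ⟨k, hk⟩ else 0) j }
  refine ⟨P, fun K hK => hK, ?_, ?_⟩
  · intro s y hy j
    obtain ⟨k, -, rfl⟩ := (PMF.mem_support_map_iff _ _ _).1 hy
    have h1 : D (σ s + k) = s := by rw [map_add, hσ', LinearMap.mem_ker.1 k.2, add_zero]
    have h2 := hlocal j ((fun i => if hi : i ∈ visible store (A j) then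
      view store (A j) (σ s + (k : Fin h → F)) ⟨i, hi⟩ else 0) - (σ s + (k : Fin h → F))) (by
        intro i hi
        simp [hi, view])
    rw [map_sub, h1] at h2
    exact sub_eq_zero.1 h2
  · intro S hS l hl
    have hjoint : P.joint = (PMF.uniformOfFintype (Secrets F r × LinearMap.ker D)).map
        fun x => (x.1, σ x.1 + x.2) := by
      rw [← uniformOfFintype_bind_map_mk]
      simp only [Protocol.joint, P, PMF.map_bind, PMF.map_comp]
      rfl
    rw [P.joint_map_secret, entropy_uniformOfFintype]
    -- Secret and view together are a surjective homomorphic image of a uniform variable, hence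
    -- uniform on the product and independent.
    have hmap : (P.joint.map fun x => (x.1 l, P.userView S x.2)) =
        PMF.uniformOfFintype ((Fin (r l) → F) × (visible P.store (S.biUnion A) → F)) := by
      rw [hjoint, PMF.map_comp]
      let f : (Secrets F r × LinearMap.ker D) →+
          (Fin (r l) → F) × (visible P.store (S.biUnion A) → F) :=
        { toFun := fun x => (x.1 l, P.userView S (σ x.1 + x.2))
          map_zero' := by
            refine Prod.ext rfl (funext fun k => ?_)
            simp [Protocol.userView, view]
          map_add' := fun x y => by
            refine Prod.ext rfl (funext fun k => ?_)
            simp only [Protocol.userView, view, Prod.fst_add, Prod.snd_add, map_add,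
              Submodule.coe_add, Pi.add_apply]
            ring }
      refine map_uniformOfFintype_of_surjective f ?_
      rintro ⟨w, u⟩
      let y₀ : Fin h → F := fun k => if hk : k ∈ visible store (S.biUnion A) then u ⟨k, hk⟩ else 0
      -- `y₀` realises the view and `y₁` corrects the secret without touching the view.
      obtain ⟨y₁, hy₁, hw⟩ := hsec S hS l hl (w - D y₀ l)
      have hker : y₀ + y₁ - σ (D (y₀ + y₁)) ∈ LinearMap.ker D := by
        rw [LinearMap.mem_ker, map_sub, hσ', sub_self]
      refine ⟨(D (y₀ + y₁), ⟨_, hker⟩), Prod.ext ?_ (funext fun k => ?_)⟩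
      · change D (y₀ + y₁) l = w
        rw [map_add, Pi.add_apply, hw]
        abel
      · change (σ (D (y₀ + y₁)) + (y₀ + y₁ - σ (D (y₀ + y₁)))) k = u k
        rw [add_sub_cancel]
        have hk : (k : Fin h) ∈ visible store (S.biUnion A) := k.2
        simp only [Pi.add_apply, hy₁ _ hk, add_zero, y₀, dif_pos hk]
    rw [hmap, condEntropy_uniformOfFintype]

/-! ### Achievability -/

/-- Hall's theorem: distinct storage cells for all symbols of all secrets. -/
theorem exists_injective_of_sum_le {n m K : ℕ} {A : Fin m → Finset (Fin n)} {r : Fin m → ℕ}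
    (h : ∀ S : Finset (Fin m), ∑ i ∈ S, r i ≤ K * (S.biUnion A).card) :
    ∃ f : (Σ j, Fin (r j)) → Fin n × Fin K, Function.Injective f ∧ ∀ c, (f c).1 ∈ A c.1 := by
  classical
  have hall := (Finset.all_card_le_biUnion_card_iff_exists_injective
    fun c : Σ j, Fin (r j) => A c.1 ×ˢ (Finset.univ : Finset (Fin K))).1 (by
      intro C
      -- The admissible cells depend only on the secrets met by `C`, so Hall's condition reduces to
      -- sets containing all symbols of those secrets.
      have h1 : C ⊆ (C.image Sigma.fst).sigma fun _ => Finset.univ := fun c hc =>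
        Finset.mem_sigma.2 ⟨Finset.mem_image_of_mem _ hc, Finset.mem_univ _⟩
      have h2 : C.biUnion (fun c => A c.1 ×ˢ (Finset.univ : Finset (Fin K))) =
          ((C.image Sigma.fst).biUnion A) ×ˢ Finset.univ := by
        ext x
        simp
      calc C.card ≤ _ := Finset.card_le_card h1
        _ = ∑ i ∈ C.image Sigma.fst, r i := by simp
        _ ≤ _ := h _
        _ = _ := by rw [h2, Finset.card_product, Finset.card_univ, Fintype.card_fin, mul_comm])
  obtain ⟨f, hf, hmem⟩ := hall
  exact ⟨f, hf, fun c => (Finset.mem_product.1 (hmem c)).1⟩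

/-- Provides the transversal for secrecy, with `B` the nodes of `A l` hidden from a user; `f₀`
merely fills in values at the other secrets. -/
theorem exists_injOn_of_le {n m K : ℕ} {r : Fin m → ℕ} {l : Fin m} {B : Finset (Fin n)}
    (h : r l ≤ K * B.card) (f₀ : (Σ j, Fin (r j)) → Fin n × Fin K) :
    ∃ f : (Σ j, Fin (r j)) → Fin n × Fin K,
      Set.InjOn f {c | c.1 = l} ∧ ∀ c, c.1 = l → (f c).1 ∈ B := by
  classical
  have hcard : Fintype.card (Fin (r l)) ≤ Fintype.card (B × Fin K) := by
    simpa [mul_comm] using h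
  obtain ⟨g⟩ := Function.Embedding.nonempty_of_card_le hcard
  refine ⟨fun c => if hc : c.1 = l then ((g (hc ▸ c.2)).1, (g (hc ▸ c.2)).2) else f₀ c, ?_, ?_⟩
  · rintro ⟨j, a⟩ rfl ⟨j', a'⟩ hj he
    obtain rfl : j' = j := hj
    simp only [dite_true, Prod.mk.injEq] at he
    have := g.injective (Prod.ext (Subtype.ext he.1) he.2)
    rw [this]
  · rintro ⟨j, a⟩ rfl
    simp

theorem isProtocolRate_of_le {F : Type*} [Field F] [Fintype F] {n m : ℕ}
    {A : Fin m → Finset (Fin n)} {t K : ℕ} (hK : 0 < K) (r : Fin m → ℕ)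
    (hsum : ∀ S : Finset (Fin m), ∑ i ∈ S, r i ≤ K * (S.biUnion A).card)
    (hsec : ∀ S : Finset (Fin m), S.card = t → ∀ l, l ∉ S → r l ≤ K * (A l \ S.biUnion A).card) :
    IsProtocolRate F A t fun j => (r j : ℝ) / K := by
  classical
  -- Rows are storage cells, `K` per node, and columns are secret symbols over `E`.
  obtain ⟨E, hE, G, hG0, hG⟩ := exists_generic_matrix F
    fun (i : Fin n × Fin K) (c : Σ j, Fin (r j)) => i.1 ∈ A c.1
  obtain ⟨f₀, hf₀, hf₀A⟩ := exists_injective_of_sum_le hsum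
  let d := Module.finrank F E
  let b : Module.Basis (Fin d) F E := Module.finBasis F E
  have hd : 0 < d := Module.finrank_pos
  let N := Fintype.card ((Fin n × Fin K) × Fin d)
  let e : ((Fin n × Fin K) × Fin d) ≃ Fin N := Fintype.equivFin _
  let store : Fin n → Finset (Fin N) := fun i =>
    ((Finset.univ : Finset (Fin K × Fin d)).image fun x => e ((i, x.1), x.2))
  have hvis : ∀ (B : Finset (Fin n)) (i : Fin n) (κ : Fin K) (δ : Fin d),
      e ((i, κ), δ) ∈ visible store B ↔ i ∈ B := by
    intro B i κ δ
    simp only [visible, store, Finset.mem_biUnion, Finset.mem_image, Finset.mem_univ, true_and,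
      EmbeddingLike.apply_eq_iff_eq, Prod.mk.injEq, Prod.exists]
    constructor
    · rintro ⟨i', hi', -, -, ⟨rfl, -⟩, -⟩
      exact hi'
    · exact fun hi => ⟨i, hi, κ, δ, ⟨rfl, rfl⟩, rfl⟩
  let Y : (Fin N → F) ≃ₗ[F] (Fin n × Fin K → E) :=
    (LinearEquiv.funCongrLeft F F e).trans
      ((LinearEquiv.curry F F (Fin n × Fin K) (Fin d)).trans
        (LinearEquiv.piCongrRight fun _ => b.equivFun.symm))
  have hY : ∀ y i, Y y i = ∑ δ, y (e (i, δ)) • b δ := fun y i => b.equivFun_symm_apply _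
  have hYsymm : ∀ z i δ, Y.symm z (e (i, δ)) = b.equivFun (z i) δ := by
    intro z i δ
    have h1 := congrFun (Y.apply_symm_apply z) i
    rw [hY, ← b.equivFun_symm_apply fun δ => Y.symm z (e (i, δ))] at h1
    rw [← h1, LinearEquiv.apply_symm_apply]
  let D : (Fin N → F) →ₗ[F] Secrets F (fun j => r j * d) :=
    { toFun := fun y j k => b.equivFun
        (∑ i, Y y i * G i ⟨j, (finProdFinEquiv.symm k).1⟩) (finProdFinEquiv.symm k).2
      map_add' := fun y y' => by
        funext j k
        simp only [map_add, Pi.add_apply, add_mul, Finset.sum_add_distrib]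
      map_smul' := fun a y => by
        funext j k
        simp only [map_smul, Pi.smul_apply, smul_mul_assoc, ← Finset.smul_sum, RingHom.id_apply] }
  have hDapply : ∀ y j k, D y j k = b.equivFun
        (∑ i, Y y i * G i ⟨j, (finProdFinEquiv.symm k).1⟩) (finProdFinEquiv.symm k).2 :=
    fun _ _ _ => rfl
  have hD : ∀ (z : Fin n × Fin K → E) (w : (j : Fin m) → Fin (r j * d) → F) (j : Fin m),
      (∀ a, ∑ i, z i * G i ⟨j, a⟩ = b.equivFun.symm fun δ => w j (finProdFinEquiv (a, δ))) →
        D (Y.symm z) j = w j := by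
    intro z w j hz
    funext k
    rw [hDapply, LinearEquiv.apply_symm_apply, hz, LinearEquiv.apply_symm_apply]
    exact congrArg (w j) (finProdFinEquiv.apply_symm_apply k)
  obtain ⟨P, hPK, hPc, hPs⟩ := exists_protocol_of_linearMap (A := A) t store D
    (by
      intro w
      obtain ⟨z, -, hz⟩ := exists_vecMul_eq G Finset.univ f₀
        (hG _ _ hf₀.injOn fun c _ => hf₀A c)
        fun c => b.equivFun.symm fun δ => w c.1 (finProdFinEquiv (c.2, δ))
      exact ⟨Y.symm z, funext fun j => hD z w j fun a => hz ⟨j, a⟩ (Finset.mem_univ _)⟩)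
    (by
      intro j y hy
      funext k
      rw [hDapply, Finset.sum_eq_zero]
      · simp
      · rintro ⟨i, κ⟩ -
        by_cases hi : i ∈ A j
        · rw [hY, Finset.sum_eq_zero, zero_mul]
          intro δ _
          rw [hy _ ((hvis _ _ _ _).2 hi), zero_smul]
        · rw [hG0 _ _ hi, mul_zero])
    (by
      intro S hS l hl w
      obtain ⟨f, hf, hfB⟩ := exists_injOn_of_le (hsec S hS l hl) f₀
      -- Only the columns of secret `l` are prescribed; the other secrets may take any value, so
      -- rows hidden from the user suffice.
      obtain ⟨z, hz0, hz⟩ := exists_vecMul_eq G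
        (Finset.univ.filter fun c : Σ j, Fin (r j) => c.1 = l) f
        (hG _ _ (by simpa using hf) fun c hc => by
          have hc' : c.1 = l := by simpa using hc
          rw [hc']
          exact (Finset.mem_sdiff.1 (hfB c hc')).1)
        fun c => b.equivFun.symm fun δ => Function.update (0 : Secrets F fun j => r j * d) l w c.1
          (finProdFinEquiv (c.2, δ))
      refine ⟨Y.symm z, fun k hk => ?_, ?_⟩
      · obtain ⟨⟨⟨i, κ⟩, δ⟩, rfl⟩ := e.surjective k
        rw [hvis] at hk
        rw [hYsymm, hz0, map_zero, Pi.zero_apply]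
        intro c hc hfc
        have := hfB c (by simpa using hc)
        rw [hfc] at this
        exact (Finset.mem_sdiff.1 this).2 hk
      · rw [hD z (Function.update (0 : Secrets F fun j => r j * d) l w) l
          fun a => hz ⟨l, a⟩ (by simp), Function.update_self])
  refine ⟨K * d, fun j => r j * d, P, Nat.mul_pos hK hd, hPK _ fun i => ?_, hPc, hPs, fun j => ?_⟩
  · exact Finset.card_image_le.trans (by simp)
  · have : (d : ℝ) ≠ 0 := by exact_mod_cast hd.ne'
    push_cast
    rw [mul_div_mul_right _ _ this]

end DMUSS

theorem theorem1 {F : Type*} [Field F] [Fintype F] (n m t : ℕ) (A : Fin m → Finset (Fin n)) :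
    DMUSS.capacityRegion F A t =
      convexHull ℝ {R : Fin m → ℝ |
        (∀ j, 0 ≤ R j) ∧
        (∀ j, ∀ S : Finset (Fin m), j ∉ S → S.card = t →
          R j ≤ ((A j \ S.biUnion A).card : ℝ)) ∧
        (∀ S : Finset (Fin m), ∑ i ∈ S, R i ≤ ((S.biUnion A).card : ℝ))} := by
  rw [Convex.convexHull_eq]
  · refine Set.Subset.antisymm (closure_minimal ?_ ?_) ?_
    · rintro R ⟨K, r, P, hK, hPK, hc, hs, hR⟩
      have hK' : (0 : ℝ) < K := by exact_mod_cast hK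
      refine ⟨fun j => ?_, fun j S hj hS => ?_, fun S => ?_⟩
      · rw [hR]
        positivity
      · rw [hR, div_le_iff₀' hK']
        exact_mod_cast P.length_le_of_weaklySecure hPK hc hs hS hj
      · simp only [hR, ← Finset.sum_div]
        rw [div_le_iff₀' hK']
        exact_mod_cast P.sum_length_le hPK hc S
    · simp only [Set.ofPred_and, Set.ofPred_forall]
      refine (isClosed_iInter fun j => ?_).inter
        ((isClosed_iInter fun j => isClosed_iInter fun S => isClosed_iInter fun _ =>
          isClosed_iInter fun _ => ?_).inter (isClosed_iInter fun S => ?_))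
      · exact isClosed_le continuous_const (continuous_apply j)
      · exact isClosed_le (continuous_apply j) continuous_const
      · exact isClosed_le (by fun_prop) continuous_const
    · rintro R ⟨h0, hsec, hsum⟩
      -- Rounding down to denominator `N` preserves every upper bound, so no interior point argument
      -- is needed.
      refine mem_closure_of_tendsto (b := Filter.atTop)
        (f := fun (N : ℕ) j => (⌊R j * N⌋₊ : ℝ) / N) (tendsto_pi_nhds.2 fun j => ?_) ?_
      · exact (tendsto_nat_floor_mul_div_atTop (h0 j)).comp tendsto_natCast_atTop_atTop
      · filter_upwards [Filter.eventually_gt_atTop 0] with N hN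
        have hfl : ∀ j, (⌊R j * N⌋₊ : ℝ) ≤ N * R j := fun j => by
          rw [mul_comm (N : ℝ)]
          exact Nat.floor_le (mul_nonneg (h0 j) N.cast_nonneg)
        refine DMUSS.isProtocolRate_of_le hN (fun j => ⌊R j * N⌋₊) (fun S => ?_)
          fun S hS l hl => ?_
        · have h1 := Finset.sum_le_sum fun j (_ : j ∈ S) => hfl j
          rw [← Finset.mul_sum] at h1
          exact_mod_cast h1.trans (mul_le_mul_of_nonneg_left (hsum S) N.cast_nonneg)
        · exact_mod_cast (hfl l).trans
            (mul_le_mul_of_nonneg_left (hsec l S hl hS) N.cast_nonneg)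
  · rintro x ⟨hx0, hx1, hx2⟩ y ⟨hy0, hy1, hy2⟩ a b ha hb hab
    have key : ∀ {u v c : ℝ}, u ≤ c → v ≤ c → a * u + b * v ≤ c := fun {u v c} hu hv => by
      calc a * u + b * v ≤ a * c + b * c := by gcongr
        _ = c := by rw [← add_mul, hab, one_mul]
    refine ⟨fun j => ?_, fun j S hj hS => key (hx1 j S hj hS) (hy1 j S hj hS), fun S => ?_⟩
    · exact add_nonneg (mul_nonneg ha (hx0 j)) (mul_nonneg hb (hy0 j))
    · simp only [Pi.add_apply, Pi.smul_apply, smul_eq_mul, Finset.sum_add_distrib,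
        ← Finset.mul_sum]
      exact key (hx2 S) (hy2 S)
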